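/- Let $f:\mathbb{R}^d\to(-\infty,+\infty]$ be a closed proper convex function, i.e. $f$ is finite at some point and its epigraph $\{(x,t)\in\mathbb{R}^d\times\mathbb{R}: f(x)\le t\}$ is convex and closed. Let $\mathcal{X}\subseteq\mathbb{R}^d$ be a set such that $f(x)=+\infty$ for every $x\notin\mathcal{X}$. (For instance, $\mathcal{X}$ is a nonempty closed convex set and $f$ is a lower semicontinuous convex function $\mathcal{X}\to\mathbb{R}$, extended by $+\infty$ outside $\mathcal{X}$.) For $x\in\mathbb{R}^d$ let $$\partial f(x)=\{v\in\mathbb{R}^d : f(z)\ge f(x)+\langle v,z-x\rangle \text{ for all } z\in\mathbb{R}^d\}$$ be the subdifferential of $f$ at $x$. Then the closure of the gradient space $\bigcup_{x\in\mathcal{X}}\partial f(x)$ is a convex set. -/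

import Mathlib

/-- The epigraph `{(x, t) : f x ≤ t}`, a subset of `E × ℝ`, of an extended-real-valued function. -/
def extEpigraph {E : Type*} (f : E → EReal) : Set (E × ℝ) :=
  {p | f p.1 ≤ (p.2 : EReal)}

/-- A closed proper convex function `f : E → (-∞, +∞]`: it never takes the value `-∞`, it is
finite somewhere, and its epigraph is convex and closed. -/
structure IsClosedProperConvex {E : Type*} [AddCommGroup E] [Module ℝ E] [TopologicalSpace E]
    (f : E → EReal) : Prop where
  ne_bot : ∀ x, f x ≠ ⊥
  exists_ne_top : ∃ x, f x ≠ ⊤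
  convex_epigraph : Convex ℝ (extEpigraph f)
  isClosed_epigraph : IsClosed (extEpigraph f)

/-- The subdifferential `∂f(x) = {v : f z ≥ f x + ⟨v, z - x⟩ for all z}`. -/
def subdifferential {E : Type*} [NormedAddCommGroup E] [InnerProductSpace ℝ E]
    (f : E → EReal) (x : E) : Set E :=
  {v | ∀ z, f x + ((inner ℝ v (z - x) : ℝ) : EReal) ≤ f z}

/-- The gradient space `⋃_{x ∈ X} ∂f(x)`. -/
def gradientSpace {E : Type*} [NormedAddCommGroup E] [InnerProductSpace ℝ E]
    (f : E → EReal) (X : Set E) : Set E :=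
  ⋃ x ∈ X, subdifferential f x

/-! The gradient space has the same closure as the convex set `affineMinorantSlopes f`. Subgradients
are slopes of affine minorants. Conversely, for such a slope `v`, a minimiser `x` of `f - ⟨v, ·⟩ +
(ε / 2) ‖·‖ ^ 2` gives `v - ε • x ∈ ∂f(x)`; as `ε‖x‖ ^ 2` stays bounded, `ε • x → 0` with `ε`. -/

/-- The slopes of the affine minorants of `f`, i.e. the effective domain of its convex conjugate. -/
def affineMinorantSlopes {E : Type*} [NormedAddCommGroup E] [InnerProductSpace ℝ E]
    (f : E → EReal) : Set E :=
  {v | ∃ c : ℝ, ∀ p ∈ extEpigraph f, inner ℝ v p.1 - c ≤ p.2}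

section

variable {E : Type*} [NormedAddCommGroup E] [InnerProductSpace ℝ E] {f : E → EReal}

theorem convex_affineMinorantSlopes (f : E → EReal) : Convex ℝ (affineMinorantSlopes f) := by
  rintro v ⟨c, hc⟩ w ⟨e, he⟩ a b ha hb hab
  refine ⟨a * c + b * e, fun p hp => ?_⟩
  have h1 := mul_le_mul_of_nonneg_left (hc p hp) ha
  have h2 := mul_le_mul_of_nonneg_left (he p hp) hb
  have h3 : a * p.2 + b * p.2 = p.2 := by rw [← add_mul, hab, one_mul]
  rw [inner_add_left, real_inner_smul_left, real_inner_smul_left]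
  linarith

theorem IsClosedProperConvex.ne_top_of_mem_subdifferential (hf : IsClosedProperConvex f)
    {x v : E} (hv : v ∈ subdifferential f x) : f x ≠ ⊤ := by
  intro hx
  obtain ⟨z, hz⟩ := hf.exists_ne_top
  have h := hv z
  rw [hx, EReal.top_add_coe, top_le_iff] at h
  exact hz h

theorem IsClosedProperConvex.subdifferential_subset_affineMinorantSlopes
    (hf : IsClosedProperConvex f) (x : E) : subdifferential f x ⊆ affineMinorantSlopes f := by
  intro v hv
  have hr := EReal.coe_toReal (hf.ne_top_of_mem_subdifferential hv) (hf.ne_bot x)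
  refine ⟨inner ℝ v x - (f x).toReal, fun p hp => ?_⟩
  have h : f x + ((inner ℝ v (p.1 - x) : ℝ) : EReal) ≤ (p.2 : EReal) := (hv p.1).trans hp
  rw [← hr, ← EReal.coe_add, EReal.coe_le_coe_iff, inner_sub_right] at h
  linarith

/-- If `v` is the slope of an affine minorant, then `f - ⟨v, ·⟩ + (ε / 2) ‖·‖ ^ 2` attains its
minimum; this is phrased on the epigraph. -/
theorem IsClosedProperConvex.exists_isMinOn_regularized [ProperSpace E]
    (hf : IsClosedProperConvex f) {v : E} (hv : v ∈ affineMinorantSlopes f) {ε : ℝ}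
    (hε : 0 < ε) :
    ∃ p ∈ extEpigraph f,
      IsMinOn (fun q : E × ℝ => q.2 - inner ℝ v q.1 + ε / 2 * ‖q.1‖ ^ 2) (extEpigraph f) p := by
  obtain ⟨c, hc⟩ := hv
  obtain ⟨x₀, hx₀⟩ := hf.exists_ne_top
  have hp₀ : (x₀, (f x₀).toReal) ∈ extEpigraph f := EReal.le_coe_toReal hx₀
  set g : E × ℝ → ℝ := fun q => q.2 - inner ℝ v q.1 + ε / 2 * ‖q.1‖ ^ 2 with hg
  have hgc : Continuous g := by fun_prop
  set M := g (x₀, (f x₀).toReal)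
  -- The minorant bounds `‖x‖ ^ 2` by `2 / ε * (M + c)` where `g ≤ M`, and `r ≤ 1 + r ^ 2`.
  set R := 1 + 2 / ε * (M + c)
  have hsub : extEpigraph f ∩ {q | g q ≤ M} ⊆
      Metric.closedBall 0 R ×ˢ Set.Icc (-(‖v‖ * R) - c) (M + ‖v‖ * R) := by
    rintro ⟨x, t⟩ ⟨hq, hqM⟩
    have h1 : inner ℝ v x - c ≤ t := hc _ hq
    have h2 : t - inner ℝ v x + ε / 2 * ‖x‖ ^ 2 ≤ M := hqM
    have h3 : ‖x‖ ^ 2 ≤ 2 / ε * (M + c) := by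
      rw [div_mul_eq_mul_div, le_div_iff₀ hε]
      linarith
    have h4 : ‖x‖ ≤ R := by
      have : R = 1 + 2 / ε * (M + c) := rfl
      nlinarith [sq_nonneg (‖x‖ - 1), norm_nonneg x]
    have h5 := abs_le.1 ((abs_real_inner_le_norm v x).trans
      (mul_le_mul_of_nonneg_left h4 (norm_nonneg v)))
    have h6 : 0 ≤ ε / 2 * ‖x‖ ^ 2 := by positivity
    refine ⟨by simpa using h4, ?_, ?_⟩
    · show _ ≤ t
      linarith [h5.1]
    · show t ≤ _
      linarith [h5.2]
  have hcomp : IsCompact (extEpigraph f ∩ {q | g q ≤ M}) :=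
    ((isCompact_closedBall 0 R).prod isCompact_Icc).of_isClosed_subset
      (hf.isClosed_epigraph.inter (isClosed_le hgc continuous_const)) hsub
  obtain ⟨p, hp, hmin⟩ := hcomp.exists_isMinOn ⟨_, hp₀, le_refl M⟩ hgc.continuousOn
  refine ⟨p, hp.1, fun q hq => ?_⟩
  rcases le_total (g q) M with h | h
  · exact hmin ⟨hq, h⟩
  · exact hp.2.trans h

theorem IsClosedProperConvex.sub_smul_mem_subdifferential_of_isMinOn
    (hf : IsClosedProperConvex f) {v : E} {ε : ℝ} {p : E × ℝ} (hp : p ∈ extEpigraph f)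
    (hmin : IsMinOn (fun q : E × ℝ => q.2 - inner ℝ v q.1 + ε / 2 * ‖q.1‖ ^ 2)
      (extEpigraph f) p) :
    v - ε • p.1 ∈ subdifferential f p.1 := by
  obtain ⟨x, t⟩ := p
  intro z
  show f x + ((inner ℝ (v - ε • x) (z - x) : ℝ) : EReal) ≤ f z
  have hx : f x ≤ (t : EReal) := hp
  by_cases hz : f z = ⊤
  · rw [hz]; exact le_top
  have hzs := EReal.coe_toReal hz (hf.ne_bot z)
  set s := (f z).toReal
  have hq : (z, s) ∈ extEpigraph f := hzs.ge
  -- Minimality against the point at parameter `l` of the segment to `(z, s)`, divided by `l`; the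
  -- quadratic error vanishes as `l → 0`.
  have key : ∀ l ∈ Set.Ioc (0 : ℝ) 1,
      t + inner ℝ (v - ε • x) (z - x) - s ≤ ε / 2 * ‖z - x‖ ^ 2 * l := by
    rintro l ⟨hl0, hl1⟩
    have hm : (x, t) + l • ((z, s) - (x, t)) ∈ extEpigraph f :=
      hf.convex_epigraph.add_smul_sub_mem hp hq ⟨hl0.le, hl1⟩
    have h : t - inner ℝ v x + ε / 2 * ‖x‖ ^ 2 ≤
        t + l * (s - t) - inner ℝ v (x + l • (z - x)) + ε / 2 * ‖x + l • (z - x)‖ ^ 2 := hmin hm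
    rw [norm_add_sq_real, inner_add_right, real_inner_smul_right, real_inner_smul_right,
      norm_smul, mul_pow, Real.norm_eq_abs, sq_abs] at h
    rw [inner_sub_left, real_inner_smul_left]
    refine le_of_mul_le_mul_left ?_ hl0
    linarith
  have hlim : Filter.Tendsto (fun l : ℝ => ε / 2 * ‖z - x‖ ^ 2 * l)
      (nhdsWithin 0 (Set.Ioi 0)) (nhds 0) := by
    have : Continuous fun l : ℝ => ε / 2 * ‖z - x‖ ^ 2 * l := by fun_prop
    simpa using (this.tendsto 0).mono_left nhdsWithin_le_nhds
  have hle : t + inner ℝ (v - ε • x) (z - x) - s ≤ 0 :=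
    ge_of_tendsto hlim (Filter.mem_of_superset (Ioc_mem_nhdsGT one_pos) key)
  calc f x + ((inner ℝ (v - ε • x) (z - x) : ℝ) : EReal)
      ≤ (t : EReal) + ((inner ℝ (v - ε • x) (z - x) : ℝ) : EReal) := by gcongr
    _ = ((t + inner ℝ (v - ε • x) (z - x) : ℝ) : EReal) := (EReal.coe_add _ _).symm
    _ ≤ (s : EReal) := EReal.coe_le_coe_iff.2 (by linarith)
    _ = f z := hzs

theorem IsClosedProperConvex.affineMinorantSlopes_subset_closure [ProperSpace E]
    (hf : IsClosedProperConvex f) :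
    affineMinorantSlopes f ⊆ closure (⋃ x, subdifferential f x) := by
  intro v hv
  rw [Metric.mem_closure_iff]
  intro δ hδ
  obtain ⟨c, hc⟩ := id hv
  obtain ⟨x₀, hx₀⟩ := hf.exists_ne_top
  have hp₀ : (x₀, (f x₀).toReal) ∈ extEpigraph f := EReal.le_coe_toReal hx₀
  set s := (f x₀).toReal
  set K := s - inner ℝ v x₀ + ‖x₀‖ ^ 2 / 2 + c with hK
  have hK0 : 0 ≤ K := by
    have : inner ℝ v x₀ - c ≤ s := hc _ hp₀
    have : 0 ≤ ‖x₀‖ ^ 2 / 2 := by positivity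
    linarith
  -- Comparison with `x₀` gives `ε‖x‖ ^ 2 ≤ 2K`, with `K` free of `ε` because `ε ≤ 1`; hence `‖ε •
  -- x‖ ^ 2 ≤ 2Kε < δ ^ 2`.
  set ε := min 1 (δ ^ 2 / (4 * (K + 1)))
  have hε : 0 < ε := lt_min one_pos (by positivity)
  have hε1 : ε ≤ 1 := min_le_left _ _
  have hεδ : ε * (4 * (K + 1)) ≤ δ ^ 2 :=
    (le_div_iff₀ (by positivity)).1 (min_le_right _ _)
  obtain ⟨⟨x, t⟩, hp, hmin⟩ := hf.exists_isMinOn_regularized hv hε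
  refine ⟨v - ε • x, Set.mem_iUnion.2
    ⟨x, hf.sub_smul_mem_subdifferential_of_isMinOn hp hmin⟩, ?_⟩
  rw [dist_eq_norm, sub_sub_cancel, norm_smul, Real.norm_of_nonneg hε.le]
  have h1 : t - inner ℝ v x + ε / 2 * ‖x‖ ^ 2 ≤ s - inner ℝ v x₀ + ε / 2 * ‖x₀‖ ^ 2 := hmin hp₀
  have h2 : inner ℝ v x - c ≤ t := hc _ hp
  have h3 : ε / 2 * ‖x₀‖ ^ 2 ≤ ‖x₀‖ ^ 2 / 2 := by
    nlinarith [mul_le_mul_of_nonneg_right hε1 (sq_nonneg ‖x₀‖)]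
  have h4 : ε * ‖x‖ ^ 2 ≤ 2 * K := by linarith
  have h5 : ε * (ε * ‖x‖ ^ 2) ≤ ε * (2 * K) := mul_le_mul_of_nonneg_left h4 hε.le
  refine lt_of_pow_lt_pow_left₀ 2 hδ.le ?_
  nlinarith [mul_nonneg hε.le hK0]

theorem IsClosedProperConvex.gradientSpace_eq_iUnion (hf : IsClosedProperConvex f) {X : Set E}
    (hX : ∀ x, x ∉ X → f x = ⊤) : gradientSpace f X = ⋃ x, subdifferential f x := by
  refine Set.Subset.antisymm (Set.iUnion₂_subset_iUnion _ _) (Set.iUnion_subset fun x v hv => ?_)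
  have hx : x ∈ X := by
    by_contra h
    exact hf.ne_top_of_mem_subdifferential hv (hX x h)
  exact Set.mem_biUnion hx hv

end

theorem mainTheorem12 (d : ℕ) (X : Set (EuclideanSpace ℝ (Fin d)))
    (f : EuclideanSpace ℝ (Fin d) → EReal) (hf : IsClosedProperConvex f)
    (hX : ∀ x, x ∉ X → f x = ⊤) :
    Convex ℝ (closure (gradientSpace f X)) := by
  have h : closure (gradientSpace f X) = closure (affineMinorantSlopes f) := by
    rw [hf.gradientSpace_eq_iUnion hX]
    exact Set.Subset.antisymm
      (closure_mono (Set.iUnion_subset hf.subdifferential_subset_affineMinorantSlopes))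
      (closure_minimal hf.affineMinorantSlopes_subset_closure isClosed_closure)
  rw [h]
  exact (convex_affineMinorantSlopes f).closure
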